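/- Let $n\ge 0$. Let $\mathrm{LC}_g(\mathbb{R}^n)$ be the class of geometric log-concave functions with finite and positive integral, that is, of functions $f:\mathbb{R}^n\to[0,\infty)$ that are upper semicontinuous, have $\log f$ concave (with $\log 0=-\infty$), and satisfy $\max f=f(0)=1$ and $0<\int_{\mathbb{R}^n} f(x)\,dx<\infty$. For $f,g:\mathbb{R}^n\to[0,\infty)$ measurable, the functional covering number of $f$ by $g$ is \[ N(f,g)=\inf\Bigl\{\mu(\mathbb{R}^n)\;:\;\int g(x-t)\,d\mu(t)\ge f(x)\ \text{ for all }x\in\mathbb{R}^n\Bigr\}, \] where the infimum is over all non-negative Borel measures $\mu$ on $\mathbb{R}^n$. Write $g_-(x)=g(-x)$, and let $(f\star g)(x)=\sup_{z\in\mathbb{R}^n} f(z)\,g(x-z)$ denote the sup-convolution. Let $f,g\in\mathrm{LC}_g(\mathbb{R}^n)$. Then for every real $p>1$, \[ \frac{\int f(x)\,dx}{\int g(x)\,dx}\;\le\; N(f,g)\;\le\;\frac{\int \bigl(f\star g_-^{\,p-1}\bigr)(x)\,dx}{\int g_-^{\,p}(x)\,dx}. \] -/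

import Mathlib

open MeasureTheory
open scoped NNReal ENNReal

namespace FunctionalCovering

/-- A log-concave function `f : ℝⁿ → [0, ∞)`: upper semicontinuous with `log f` concave, where
`log 0 = -∞`; concavity of `log f` is written multiplicatively. -/
structure IsLogConcave {n : ℕ} (f : EuclideanSpace ℝ (Fin n) → ℝ≥0) : Prop where
  upperSemicontinuous : UpperSemicontinuous f
  log_concave : ∀ (x y : EuclideanSpace ℝ (Fin n)) (a b : ℝ), 0 < a → 0 < b → a + b = 1 →
    f x ^ a * f y ^ b ≤ f (a • x + b • y)

/-- The class `LC_g(ℝⁿ)` of geometric log-concave functions with finite and positive integral: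
log-concave functions `f` with `max f = f 0 = 1` and `0 < ∫ f < ∞`. -/
structure LCg {n : ℕ} (f : EuclideanSpace ℝ (Fin n) → ℝ≥0) : Prop extends IsLogConcave f where
  map_zero : f 0 = 1
  le_one : ∀ x, f x ≤ 1
  integral_pos : 0 < ∫⁻ x, (f x : ℝ≥0∞)
  integral_lt_top : ∫⁻ x, (f x : ℝ≥0∞) < ∞

/-- The reflection `g₋(x) = g(-x)`. -/
def refl {n : ℕ} (g : EuclideanSpace ℝ (Fin n) → ℝ≥0) : EuclideanSpace ℝ (Fin n) → ℝ≥0 :=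
  fun x => g (-x)

/-- The sup-convolution `(f ⋆ g)(x) = sup_z f(z) g(x - z)`, with values in `[0, ∞]`. -/
noncomputable def supConv {n : ℕ} (f g : EuclideanSpace ℝ (Fin n) → ℝ≥0)
    (x : EuclideanSpace ℝ (Fin n)) : ℝ≥0∞ :=
  ⨆ z, (f z : ℝ≥0∞) * (g (x - z) : ℝ≥0∞)

/-- `μ` is a covering measure of `f` by `g`: `(μ * g)(x) = ∫ g(x - t) dμ(t) ≥ f(x)` for all `x`. -/
def IsCoveringMeasure {n : ℕ} (f g : EuclideanSpace ℝ (Fin n) → ℝ≥0)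
    (μ : Measure (EuclideanSpace ℝ (Fin n))) : Prop :=
  ∀ x, (f x : ℝ≥0∞) ≤ ∫⁻ t, (g (x - t) : ℝ≥0∞) ∂μ

/-- The `h`-covering number `N(f, g, h)`: the infimum of `∫ h dμ` over all nonnegative Borel
measures `μ` covering `f` by `g`. -/
noncomputable def weightedCoveringNumber {n : ℕ} (f g h : EuclideanSpace ℝ (Fin n) → ℝ≥0) :
    ℝ≥0∞ :=
  ⨅ (μ : Measure (EuclideanSpace ℝ (Fin n))) (_ : IsCoveringMeasure f g μ),
    ∫⁻ t, (h t : ℝ≥0∞) ∂μ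

/-- The functional covering number `N(f, g) = N(f, g, 1)`. -/
noncomputable def coveringNumber {n : ℕ} (f g : EuclideanSpace ℝ (Fin n) → ℝ≥0) : ℝ≥0∞ :=
  weightedCoveringNumber f g (fun _ => 1)

end FunctionalCovering

namespace FunctionalCovering

variable {n : ℕ} {f g : EuclideanSpace ℝ (Fin n) → ℝ≥0}

/-! Lower bound: by Tonelli and translation invariance, a covering measure `μ` satisfies `∫ f ≤
μ(ℝⁿ) ∫ g`. Upper bound: an explicit measure covers. Keeping only `z = x` in the supremum, its
density at `t` is at least `f(x) g(x - t)^(p-1) / ∫ g₋^p`; integrating this against `g(x - t)` gives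
exactly `f(x)`. Concavity plays no role: `g ≤ 1` makes `∫ g^p` finite. -/

/-- Integrating the covering inequality gives the volume lower bound. -/
theorem lintegral_div_le_coveringNumber (hg : Measurable g)
    (hg0 : ∫⁻ x, (g x : ℝ≥0∞) ≠ 0) (hgt : ∫⁻ x, (g x : ℝ≥0∞) ≠ ∞) :
    (∫⁻ x, (f x : ℝ≥0∞)) / (∫⁻ x, (g x : ℝ≥0∞)) ≤ coveringNumber f g := by
  refine le_iInf₂ fun μ hμ => ?_
  simp only [ENNReal.coe_one, lintegral_one]
  -- Tonelli needs s-finiteness, which an arbitrary `μ` may lack; infinite mass makes the bound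
  -- trivial.
  by_cases hμt : μ Set.univ = ∞
  · simp [hμt]
  have : IsFiniteMeasure μ := ⟨lt_top_iff_ne_top.2 hμt⟩
  refine (ENNReal.div_le_iff hg0 hgt).2 ?_
  calc ∫⁻ x, (f x : ℝ≥0∞) ≤ ∫⁻ x, ∫⁻ t, (g (x - t) : ℝ≥0∞) ∂μ := lintegral_mono hμ
    _ = ∫⁻ t, ∫⁻ x, (g (x - t) : ℝ≥0∞) ∂volume ∂μ :=
        lintegral_lintegral_swap (by fun_prop)
    _ = ∫⁻ _, ∫⁻ x, (g x : ℝ≥0∞) ∂volume ∂μ := by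
        congr with t
        exact lintegral_sub_right_eq_self (fun x => (g x : ℝ≥0∞)) t
    _ = μ Set.univ * ∫⁻ x, (g x : ℝ≥0∞) := by rw [lintegral_const, mul_comm]

/-- The measure with density `(f ⋆ g₋ ^ (p - 1)) / ∫ g₋ ^ p` covers `f` by `g`. -/
theorem isCoveringMeasure_withDensity_supConv (hg : Measurable g) {p : ℝ} (hp : p ≠ 0)
    (h0 : ∫⁻ x, ((refl g x ^ p : ℝ≥0) : ℝ≥0∞) ≠ 0)
    (ht : ∫⁻ x, ((refl g x ^ p : ℝ≥0) : ℝ≥0∞) ≠ ∞) :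
    IsCoveringMeasure f g ((∫⁻ x, ((refl g x ^ p : ℝ≥0) : ℝ≥0∞))⁻¹ •
      volume.withDensity (supConv f fun y => refl g y ^ (p - 1))) := by
  intro x
  set c := ∫⁻ x, ((refl g x ^ p : ℝ≥0) : ℝ≥0∞) with hc
  -- The `z = x` term is measurable, so measurability of the supremum is never needed.
  set k : EuclideanSpace ℝ (Fin n) → ℝ≥0∞ := fun t =>
    (f x : ℝ≥0∞) * ((refl g (t - x) ^ (p - 1) : ℝ≥0) : ℝ≥0∞) with hk
  have hgm : Measurable (refl g) := hg.comp measurable_neg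
  have hkm : Measurable k := by fun_prop
  have hle : volume.withDensity k ≤
      volume.withDensity (supConv f fun y => refl g y ^ (p - 1)) :=
    withDensity_mono (Filter.Eventually.of_forall fun t =>
      le_iSup (fun z => (f z : ℝ≥0∞) * ((refl g (t - z) ^ (p - 1) : ℝ≥0) : ℝ≥0∞)) x)
  have hpt (t : EuclideanSpace ℝ (Fin n)) :
      k t * (g (x - t) : ℝ≥0∞) = (f x : ℝ≥0∞) * ((refl g (t - x) ^ p : ℝ≥0) : ℝ≥0∞) := by
    have hr : refl g (t - x) = g (x - t) := by simp [refl]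
    rw [hk]
    simp only [hr]
    rw [mul_assoc, ← ENNReal.coe_mul]
    congr 2
    -- At a zero of `g`, `p ≠ 0` is essential because `0 ^ 0 = 1`.
    rcases eq_or_ne (g (x - t)) 0 with h | h
    · simp [h, NNReal.zero_rpow hp]
    · rw [NNReal.rpow_sub_one h, div_mul_cancel₀ _ h]
  have hint : ∫⁻ t, (g (x - t) : ℝ≥0∞) ∂(volume.withDensity k) = f x * c := by
    rw [lintegral_withDensity_eq_lintegral_mul _ hkm (by fun_prop)]
    simp only [Pi.mul_apply, hpt]
    rw [lintegral_const_mul _ (by fun_prop),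
      lintegral_sub_right_eq_self (fun t => ((refl g t ^ p : ℝ≥0) : ℝ≥0∞)) x]
  rw [lintegral_smul_measure, smul_eq_mul]
  calc (f x : ℝ≥0∞) = c⁻¹ * (f x * c) := by
        rw [mul_left_comm, ENNReal.inv_mul_cancel h0 ht, mul_one]
    _ ≤ _ := by
        rw [← hint]
        gcongr

theorem coveringNumber_le_lintegral_supConv_div (hg : Measurable g) {p : ℝ} (hp : p ≠ 0)
    (h0 : ∫⁻ x, ((refl g x ^ p : ℝ≥0) : ℝ≥0∞) ≠ 0)
    (ht : ∫⁻ x, ((refl g x ^ p : ℝ≥0) : ℝ≥0∞) ≠ ∞) :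
    coveringNumber f g ≤ (∫⁻ x, supConv f (fun y => refl g y ^ (p - 1)) x) /
      (∫⁻ x, ((refl g x ^ p : ℝ≥0) : ℝ≥0∞)) := by
  refine (iInf₂_le _ (isCoveringMeasure_withDensity_supConv hg hp h0 ht)).trans_eq ?_
  simp [ENNReal.div_eq_inv_mul]

theorem lintegral_refl_rpow (g : EuclideanSpace ℝ (Fin n) → ℝ≥0) (p : ℝ) :
    ∫⁻ x, ((refl g x ^ p : ℝ≥0) : ℝ≥0∞) = ∫⁻ x, ((g x ^ p : ℝ≥0) : ℝ≥0∞) :=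
  lintegral_neg_eq_self (fun x => ((g x ^ p : ℝ≥0) : ℝ≥0∞))

theorem LCg.lintegral_rpow_ne_zero (hg : LCg g) {p : ℝ} (hp : 0 < p) :
    ∫⁻ x, ((g x ^ p : ℝ≥0) : ℝ≥0∞) ≠ 0 := by
  have hgm : Measurable g := hg.upperSemicontinuous.measurable
  intro h
  rw [lintegral_eq_zero_iff (by fun_prop)] at h
  refine hg.integral_pos.ne' ((lintegral_eq_zero_iff (by fun_prop)).2 ?_)
  filter_upwards [h] with x hx
  simpa [NNReal.rpow_eq_zero hp.ne'] using hx

theorem LCg.lintegral_rpow_ne_top (hg : LCg g) {p : ℝ} (hp : 1 ≤ p) :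
    ∫⁻ x, ((g x ^ p : ℝ≥0) : ℝ≥0∞) ≠ ∞ := by
  refine ((lintegral_mono fun x => ?_).trans_lt hg.integral_lt_top).ne
  exact ENNReal.coe_le_coe.2 (NNReal.rpow_le_self_of_le_one (hg.le_one x) hp)

end FunctionalCovering

theorem theorem4p1 {n : ℕ} (f g : EuclideanSpace ℝ (Fin n) → ℝ≥0)
    (hf : FunctionalCovering.LCg f) (hg : FunctionalCovering.LCg g) (p : ℝ) (hp : 1 < p) :
    (∫⁻ x, (f x : ℝ≥0∞)) / (∫⁻ x, (g x : ℝ≥0∞)) ≤ FunctionalCovering.coveringNumber f g ∧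
    FunctionalCovering.coveringNumber f g ≤
      (∫⁻ x, FunctionalCovering.supConv f (fun y => FunctionalCovering.refl g y ^ (p - 1)) x) /
        (∫⁻ x, ((FunctionalCovering.refl g x ^ p : ℝ≥0) : ℝ≥0∞)) := by
  have hgm : Measurable g := hg.upperSemicontinuous.measurable
  have hp0 : 0 < p := one_pos.trans hp
  refine ⟨FunctionalCovering.lintegral_div_le_coveringNumber hgm hg.integral_pos.ne'
    hg.integral_lt_top.ne,
    FunctionalCovering.coveringNumber_le_lintegral_supConv_div hgm hp0.ne' ?_ ?_⟩
  · rw [FunctionalCovering.lintegral_refl_rpow]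
    exact hg.lintegral_rpow_ne_zero hp0
  · rw [FunctionalCovering.lintegral_refl_rpow]
    exact hg.lintegral_rpow_ne_top hp.le
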